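/- Conventions. Let $\mathbb N=\{1,2,3,\dots\}$ and let $\mathcal O$ be the set of non-decreasing sequences $a:\mathbb N\to[0,\infty)$. Write $a\approx b$ if there are constants $c,C>0$ with $c\,a(n)\le b(n)\le C\,a(n)$ for all $n$; let $\mathbb O=\mathcal O/\!\approx$, and let $[a(n)]$ be the class of $a$. The set $\mathbb O$ is partially ordered by $[a(n)]\le[b(n)]$ iff there is $C>0$ with $a(n)\le C\,b(n)$ for all $n$. Let $\overline{\mathbb O}\supset\mathbb O$ be its Dedekind–MacNeille completion, in which all suprema below are taken. The class $[1]$ is called the constant order. For a continuous self-map $S$ of a compact metric space $(Y,d)$, put $d_n(x,y)=\max_{0\le i<n}d(S^ix,S^iy)$, and let $\mathrm{Sep}(S,n,\varepsilon)$ be the maximal cardinality of a set $A\subset Y$ with $d_n(x,y)\ge\varepsilon$ for all distinct $x,y\in A$. The generalized entropy of $S$ is $o(S)=\sup\{[\mathrm{Sep}(S,n,\varepsilon)]:\varepsilon>0\}\in\overline{\mathbb O}$. For a homeomorphism $T:S^1\to S^1$ of the circle, let $T_*\mu=\mu\circ T^{-1}$ be the induced map on the space $\mathcal M(S^1)$ of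 Borel probability measures with the weak-$*$ topology, metrized by any metric that induces this topology. **Corollary.** Let $T:S^1\to S^1$ be a homeomorphism of the circle. Then, for every metric on $\mathcal M(S^1)$ inducing the weak-$*$ topology, either $o(T_*)\ge\sup\{[n^t]:t\in(0,\infty)\}$ or $o(T_*)=[1]$. -/

import Mathlib

open MeasureTheory

noncomputable section

namespace GrowthOrder

/-! ### Orders of growth -/

/-- Non-decreasing sequences `a : {1, 2, 3, …} → [0, ∞)`. -/
structure GrowthSeq where
  toFun : ℕ+ → ℝ
  nonneg : ∀ n, 0 ≤ toFun n
  le_succ : ∀ n, toFun n ≤ toFun (n + 1)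

/-- `a ≈ b` if `c * a n ≤ b n ≤ C * a n` for all `n`, for some constants `c, C > 0`. -/
def GrowthSeq.Equivalent (a b : GrowthSeq) : Prop :=
  ∃ c : ℝ, 0 < c ∧ ∃ C : ℝ, 0 < C ∧ ∀ n, c * a.toFun n ≤ b.toFun n ∧ b.toFun n ≤ C * a.toFun n

/-- `a` is dominated by `b` if `a n ≤ C * b n` for all `n`, for some constant `C > 0`. -/
def GrowthSeq.Dominated (a b : GrowthSeq) : Prop :=
  ∃ C : ℝ, 0 < C ∧ ∀ n, a.toFun n ≤ C * b.toFun n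

theorem GrowthSeq.Dominated.refl (a : GrowthSeq) : a.Dominated a :=
  ⟨1, one_pos, fun n => by simp⟩

theorem GrowthSeq.Dominated.trans {a b c : GrowthSeq} (h₁ : a.Dominated b) (h₂ : b.Dominated c) :
    a.Dominated c := by
  obtain ⟨C, hC, h⟩ := h₁
  obtain ⟨D, hD, k⟩ := h₂
  refine ⟨C * D, mul_pos hC hD, fun n => (h n).trans ?_⟩
  rw [mul_assoc]
  exact mul_le_mul_of_nonneg_left (k n) hC.le

theorem GrowthSeq.equivalent_iff {a b : GrowthSeq} :
    a.Equivalent b ↔ a.Dominated b ∧ b.Dominated a := by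
  constructor
  · rintro ⟨c, hc, C, hC, h⟩
    exact ⟨⟨c⁻¹, inv_pos.2 hc, fun n => (le_inv_mul_iff₀ hc).2 (h n).1⟩,
      ⟨C, hC, fun n => (h n).2⟩⟩
  · rintro ⟨⟨c, hc, h⟩, ⟨C, hC, k⟩⟩
    exact ⟨c⁻¹, inv_pos.2 hc, C, hC, fun n => ⟨(inv_mul_le_iff₀ hc).2 (h n), k n⟩⟩

instance growthSetoid : Setoid GrowthSeq where
  r := GrowthSeq.Equivalent
  iseqv :=
    { refl := fun a => GrowthSeq.equivalent_iff.2 ⟨.refl a, .refl a⟩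
      symm := fun h => GrowthSeq.equivalent_iff.2 (GrowthSeq.equivalent_iff.1 h).symm
      trans := fun h k => GrowthSeq.equivalent_iff.2
        ⟨(GrowthSeq.equivalent_iff.1 h).1.trans (GrowthSeq.equivalent_iff.1 k).1,
          (GrowthSeq.equivalent_iff.1 k).2.trans (GrowthSeq.equivalent_iff.1 h).2⟩ }

/-- The space of orders of growth: growth sequences modulo equivalence. -/
def GrowthClass : Type := Quotient growthSetoid

/-- The class `[a(n)]` of a growth sequence. -/
def GrowthClass.mk (a : GrowthSeq) : GrowthClass := Quotient.mk growthSetoid a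

/-- `[a(n)] ≤ [b(n)]` iff `a n ≤ C * b n` for all `n`, for some constant `C > 0`. -/
instance : LE GrowthClass where
  le := Quotient.lift₂ GrowthSeq.Dominated fun _ _ _ _ h k =>
    propext
      ⟨fun d => ((GrowthSeq.equivalent_iff.1 h).2.trans d).trans (GrowthSeq.equivalent_iff.1 k).1,
        fun d => ((GrowthSeq.equivalent_iff.1 h).1.trans d).trans (GrowthSeq.equivalent_iff.1 k).2⟩

instance : PartialOrder GrowthClass where
  le_refl := fun x => Quotient.inductionOn x GrowthSeq.Dominated.refl
  le_trans := fun x y z => Quotient.inductionOn₃ x y z fun _ _ _ h k =>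
    GrowthSeq.Dominated.trans h k
  le_antisymm := fun x y => Quotient.inductionOn₂ x y fun _ _ h k =>
    Quotient.sound (GrowthSeq.equivalent_iff.2 ⟨h, k⟩)

/-- The Dedekind–MacNeille completion of the space of orders of growth (a complete lattice). -/
abbrev CompleteOrder : Type := DedekindCut GrowthClass

/-- The canonical embedding of the orders of growth in the completion. -/
def GrowthClass.toComplete (o : GrowthClass) : CompleteOrder := DedekindCut.principal o

/-- The supremum, in the completion, of a set of orders of growth. -/
def supOrders (S : Set GrowthClass) : CompleteOrder := sSup (GrowthClass.toComplete '' S)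

/-- The constant sequence `1`. -/
def oneSeq : GrowthSeq where
  toFun _ := 1
  nonneg _ := zero_le_one
  le_succ _ := le_rfl

/-- The constant order of growth `[1]`, as an element of the completion. -/
def constOrder : CompleteOrder := (GrowthClass.mk oneSeq).toComplete

/-- The sequence `n ^ t` (real exponent `t > 0`). -/
def powSeq (t : ℝ) (ht : 0 < t) : GrowthSeq where
  toFun n := (n : ℝ) ^ t
  nonneg n := Real.rpow_nonneg (Nat.cast_nonneg _) t
  le_succ n := Real.rpow_le_rpow (Nat.cast_nonneg _) (by push_cast; linarith) ht.le

/-- The family of polynomial orders of growth `{[n ^ t] : t > 0}`. -/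
def polynomialOrders : Set GrowthClass := {o | ∃ (t : ℝ) (ht : 0 < t), o = GrowthClass.mk (powSeq t ht)}

/-! ### Generalized topological entropy -/

/-- A metric on a topological space that induces its topology. -/
structure CompatibleMetric (Y : Type*) [t : TopologicalSpace Y] where
  toMetricSpace : MetricSpace Y
  topology_eq : toMetricSpace.toPseudoMetricSpace.toUniformSpace.toTopologicalSpace = t

/-- The distance function of a compatible metric. -/
def CompatibleMetric.d {Y : Type*} [TopologicalSpace Y] (ρ : CompatibleMetric Y) (x y : Y) : ℝ :=
  ρ.toMetricSpace.dist x y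

section Entropy

variable {Y : Type*} [TopologicalSpace Y]

/-- The dynamical distance `d_n(x, y) = max {d(Tⁱ x, Tⁱ y) : 0 ≤ i < n}`, for `n ≥ 1`. -/
def dynDist (ρ : CompatibleMetric Y) (T : C(Y, Y)) (n : ℕ+) (x y : Y) : ℝ :=
  (Finset.range n).sup' (Finset.nonempty_range_iff.2 n.ne_zero)
    fun i => ρ.d (T^[i] x) (T^[i] y)

/-- `A` is `(n, ε)`-separated: `d_n(x, y) ≥ ε` for distinct `x, y ∈ A`. -/
def IsSeparated (ρ : CompatibleMetric Y) (T : C(Y, Y)) (n : ℕ+) (ε : ℝ) (A : Finset Y) : Prop :=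
  ∀ x ∈ A, ∀ y ∈ A, x ≠ y → ε ≤ dynDist ρ T n x y

/-- `Sep(T, n, ε)`, the maximal cardinality of an `(n, ε)`-separated set. -/
def sep (ρ : CompatibleMetric Y) (T : C(Y, Y)) (n : ℕ+) (ε : ℝ) : ℕ :=
  sSup {k | ∃ A : Finset Y, IsSeparated ρ T n ε A ∧ A.card = k}

/-- On a compact space the cardinalities of `(n, ε)`-separated sets are bounded,
so that `sep` is a genuine maximum. -/
theorem bddAbove_card [CompactSpace Y] (ρ : CompatibleMetric Y) (T : C(Y, Y)) (n : ℕ+) {ε : ℝ}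
    (hε : 0 < ε) : BddAbove {k | ∃ A : Finset Y, IsSeparated ρ T n ε A ∧ A.card = k} := by
  classical
  obtain ⟨m, hm⟩ := ρ
  subst hm
  let U : Y → Set Y := fun x => {y | ∀ i ∈ Finset.range n, dist (T^[i] x) (T^[i] y) < ε / 2}
  have hU : ∀ x, U x ∈ nhds x := fun x => by
    refine (Filter.eventually_all_finset (Finset.range n)).2 fun i _ => ?_
    have hc : Continuous fun y => dist (T^[i] x) (T^[i] y) :=
      continuous_const.dist (T.continuous.iterate i)
    exact hc.continuousAt.eventually_lt continuousAt_const (by simpa using half_pos hε)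
  obtain ⟨s, -, hs⟩ := isCompact_univ.elim_nhds_subcover U fun x _ => hU x
  refine ⟨s.card, ?_⟩
  rintro _ ⟨A, hA, rfl⟩
  have hc : ∀ y, ∃ x ∈ s, y ∈ U x := fun y => by simpa using hs (Set.mem_univ y)
  choose f hfs hf using hc
  refine Finset.card_le_card_of_injOn f (fun y _ => hfs y) fun x hx y hy hxy => ?_
  by_contra hne
  have h := hA x hx y hy hne
  obtain ⟨i, hi, hle⟩ := (Finset.le_sup'_iff _).1 h
  have h₁ := hf x i hi
  have h₂ := hf y i hi
  rw [hxy] at h₁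
  have h₃ := dist_triangle_left (T^[i] x) (T^[i] y) (T^[i] (f y))
  have h₄ : ε ≤ dist (T^[i] x) (T^[i] y) := hle
  linarith

theorem sep_mono [CompactSpace Y] (ρ : CompatibleMetric Y) (T : C(Y, Y)) {ε : ℝ} (hε : 0 < ε)
    (n : ℕ+) : sep ρ T n ε ≤ sep ρ T (n + 1) ε := by
  refine csSup_le_csSup (bddAbove_card ρ T (n + 1) hε)
    ⟨0, ∅, by simp [IsSeparated], rfl⟩ ?_
  rintro _ ⟨A, hA, rfl⟩
  refine ⟨A, fun x hx y hy hxy => (hA x hx y hy hxy).trans ?_, rfl⟩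
  exact Finset.sup'_mono _ (Finset.range_mono (by simp)) _

/-- The growth sequence `n ↦ Sep(T, n, ε)`. -/
def sepSeq [CompactSpace Y] (ρ : CompatibleMetric Y) (T : C(Y, Y)) (ε : ℝ) (hε : 0 < ε) :
    GrowthSeq where
  toFun n := sep ρ T n ε
  nonneg _ := Nat.cast_nonneg _
  le_succ n := Nat.cast_le.2 (sep_mono ρ T hε n)

/-- The generalized entropy `o(T) = sup {[Sep(T, n, ε)] : ε > 0}` of a continuous self-map of a
compact metrizable space, computed with the metric `ρ`. -/
def genEntropy [CompactSpace Y] (ρ : CompatibleMetric Y) (T : C(Y, Y)) : CompleteOrder :=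
  supOrders {o | ∃ (ε : ℝ) (hε : 0 < ε), o = GrowthClass.mk (sepSeq ρ T ε hε)}

end Entropy

/-! ### The circle and the measure-induced map -/

/-- The Borel σ-algebra on the unit circle. -/
instance circleMeasurableSpace : MeasurableSpace Circle := borel Circle

instance circleBorelSpace : BorelSpace Circle := ⟨rfl⟩

/-- The push-forward map `T_* μ = μ ∘ T⁻¹` on the space of Borel probability measures, which carries
the weak-* topology. -/
def measureInduced {X : Type*} [TopologicalSpace X] [MeasurableSpace X] [BorelSpace X]
    (T : C(X, X)) : C(ProbabilityMeasure X, ProbabilityMeasure X) where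
  toFun μ := μ.map T.continuous.measurable.aemeasurable
  continuous_toFun := ProbabilityMeasure.continuous_map T.continuous

end GrowthOrder

end

/-! If the forward iterates of `T` are equicontinuous, then so are those of `T_*`: pushing forward
is jointly continuous on `C(X, X) × 𝓜(X)` and the iterates of `T` have compact closure in `C(X, X)`.
Hence `Sep(T_*, n, ε)` stays bounded in `n`.

Otherwise there is a nonempty open set `U` with `U, T⁻¹U, T⁻²U, …` pairwise disjoint. Choose `p i`
with `Tⁱ (p i) = x ∈ U` and a function `f` supported in `U` with `f x = 1`. For fixed weights
`w 0, …, w (k - 1)` with distinct subset sums, the measures `∑ l, w l • δ (p (a l))` with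
`a : Fin k → Fin n` are then told apart by the integrals of `f` along the orbit, uniformly in `n`,
so that `Sep(T_*, n, ε) ≥ n ^ k`.

To find `U`, note that failure of equicontinuity makes arbitrarily short arcs grow to a definite
length, so that by pigeonhole one open arc `K` has arbitrarily small preimages `T⁻ⁿK`. The
translates of `K` then cannot cover the circle. Let `I` be a component of their union. Either `I` is
wandering, or it is mapped onto itself by some power of `T`, which permutes the endpoints of `I` and
so produces a periodic point. In that case a power of `T` acts on the complement of this point as a
homeomorphism `g` of the line, and `g²` is increasing, even if `g` reverses orientation. It is not
the identity, since `T` does not have finite order, and the interval between a point and its image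
under an increasing map is wandering. Finally, a wandering open set of a power of `T` contains one
of `T` itself.
-/

open Filter Set Topology

namespace GrowthOrder

section Entropy

variable {Y : Type*} [TopologicalSpace Y] (ρ : CompatibleMetric Y) (T : C(Y, Y))

namespace CompatibleMetric

theorem continuous_d : Continuous fun z : Y × Y => ρ.d z.1 z.2 := by
  obtain ⟨m, rfl⟩ := ρ
  exact continuous_dist

theorem d_self (x : Y) : ρ.d x x = 0 :=
  ρ.toMetricSpace.dist_self x

theorem d_comm (x y : Y) : ρ.d x y = ρ.d y x :=
  ρ.toMetricSpace.dist_comm x y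

theorem d_triangle (x y z : Y) : ρ.d x z ≤ ρ.d x y + ρ.d y z :=
  ρ.toMetricSpace.dist_triangle x y z

theorem exists_le_d_of_le_abs_sub [CompactSpace Y] {F : Y → ℝ} (hF : Continuous F) {η : ℝ}
    (hη : 0 < η) : ∃ ε > 0, ∀ x y, η ≤ |F x - F y| → ε ≤ ρ.d x y := by
  obtain ⟨m, rfl⟩ := ρ
  obtain ⟨ε, hε, h⟩ := Metric.uniformContinuous_iff.1
    (CompactSpace.uniformContinuous_of_continuous hF) η hη
  exact ⟨ε, hε, fun x y hxy => le_of_not_gt fun hlt => (h hlt).not_ge hxy⟩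

end CompatibleMetric

theorem le_dynDist {n : ℕ+} {i : ℕ} (hi : i < n) (x y : Y) :
    ρ.d (T^[i] x) (T^[i] y) ≤ dynDist ρ T n x y :=
  Finset.le_sup' (fun i => ρ.d (T^[i] x) (T^[i] y)) (Finset.mem_range.2 hi)

theorem dynDist_comm (n : ℕ+) (x y : Y) : dynDist ρ T n x y = dynDist ρ T n y x := by
  simp only [dynDist, ρ.d_comm]

theorem dynDist_triangle (n : ℕ+) (x y z : Y) :
    dynDist ρ T n x z ≤ dynDist ρ T n x y + dynDist ρ T n y z :=
  Finset.sup'_le _ _ fun _ hi =>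
    have hi := Finset.mem_range.1 hi
    (ρ.d_triangle _ _ _).trans (add_le_add (le_dynDist ρ T hi x y) (le_dynDist ρ T hi y z))

theorem sep_le_card {n : ℕ+} {ε : ℝ} {s : Finset Y}
    (hs : ∀ y, ∃ x ∈ s, dynDist ρ T n x y < ε / 2) : sep ρ T n ε ≤ s.card := by
  choose f hfs hf using hs
  refine csSup_le ⟨0, ∅, by simp [IsSeparated], rfl⟩ ?_
  rintro _ ⟨A, hA, rfl⟩
  refine Finset.card_le_card_of_injOn f (fun y _ => hfs y) fun x hx y hy hxy => ?_
  by_contra hne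
  have hx' : dynDist ρ T n x (f y) < ε / 2 := by rw [dynDist_comm, ← hxy]; exact hf x
  linarith [hA x hx y hy hne, dynDist_triangle ρ T n x (f y) y, hf y]

variable [CompactSpace Y]

theorem card_le_sep {n : ℕ+} {ε : ℝ} (hε : 0 < ε) {A : Finset Y} (hA : IsSeparated ρ T n ε A) :
    A.card ≤ sep ρ T n ε :=
  le_csSup (bddAbove_card ρ T n hε) ⟨A, hA, rfl⟩

theorem one_le_sep [Nonempty Y] (n : ℕ+) {ε : ℝ} (hε : 0 < ε) : 1 ≤ sep ρ T n ε := by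
  obtain ⟨y⟩ := ‹Nonempty Y›
  refine card_le_sep ρ T hε (A := {y}) fun x hx z hz hxz => ?_
  rw [Finset.mem_singleton] at hx hz
  exact absurd (hx.trans hz.symm) hxz

theorem exists_card_le_sep {F : Y → ℝ} (hF : Continuous F) {η : ℝ} (hη : 0 < η) :
    ∃ ε > 0, ∀ (n : ℕ+) {ι : Type*} [Fintype ι] (μ : ι → Y),
      (∀ a b, a ≠ b → ∃ i < (n : ℕ), η ≤ |F (T^[i] (μ a)) - F (T^[i] (μ b))|) →
        Fintype.card ι ≤ sep ρ T n ε := by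
  obtain ⟨ε, hε, h⟩ := ρ.exists_le_d_of_le_abs_sub hF hη
  refine ⟨ε, hε, fun n ι _ μ hμ => ?_⟩
  have hinj : Function.Injective μ := fun a b hab => by
    by_contra hne
    obtain ⟨i, -, hi⟩ := hμ a b hne
    rw [hab, sub_self, abs_zero] at hi
    exact hi.not_gt hη
  rw [← Finset.card_univ, ← Finset.card_map ⟨μ, hinj⟩]
  refine card_le_sep ρ T hε fun x hx y hy hxy => ?_
  obtain ⟨a, -, rfl⟩ := Finset.mem_map.1 hx
  obtain ⟨b, -, rfl⟩ := Finset.mem_map.1 hy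
  obtain ⟨i, hi, hη⟩ := hμ a b (ne_of_apply_ne _ hxy)
  exact (h _ _ hη).trans (le_dynDist ρ T hi _ _)

theorem toComplete_le_genEntropy {a : GrowthSeq} {ε : ℝ} (hε : 0 < ε)
    (h : a.Dominated (sepSeq ρ T ε hε)) : (GrowthClass.mk a).toComplete ≤ genEntropy ρ T :=
  (DedekindCut.principal_le_principal.2 (show GrowthClass.mk a ≤ GrowthClass.mk _ from h)).trans
    (le_sSup ⟨_, ⟨ε, hε, rfl⟩, rfl⟩)

theorem supOrders_polynomialOrders_le_genEntropy
    (h : ∀ k : ℕ, k ≠ 0 → ∃ ε > 0, ∀ n : ℕ+, (n : ℕ) ^ k ≤ sep ρ T n ε) :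
    supOrders polynomialOrders ≤ genEntropy ρ T := by
  refine sSup_le ?_
  rintro _ ⟨_, ⟨t, ht, rfl⟩, rfl⟩
  obtain ⟨ε, hε, hsep⟩ := h ⌈t⌉₊ (Nat.ceil_pos.2 ht).ne'
  refine toComplete_le_genEntropy ρ T hε ⟨1, one_pos, fun n => ?_⟩
  have hn : (1 : ℝ) ≤ (n : ℕ) := Nat.one_le_cast.2 n.pos
  calc ((n : ℕ) : ℝ) ^ t
      ≤ ((n : ℕ) : ℝ) ^ (⌈t⌉₊ : ℝ) := Real.rpow_le_rpow_of_exponent_le hn (Nat.le_ceil t)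
    _ ≤ sep ρ T n ε := by rw [Real.rpow_natCast]; exact_mod_cast hsep n
    _ = 1 * sep ρ T n ε := (one_mul _).symm

theorem constOrder_le_genEntropy [Nonempty Y] : constOrder ≤ genEntropy ρ T :=
  toComplete_le_genEntropy ρ T one_pos ⟨1, one_pos, fun n => by
    rw [one_mul]
    exact Nat.one_le_cast.2 (one_le_sep ρ T n one_pos)⟩

theorem genEntropy_le_constOrder
    (hT : ∀ y, ∀ ε > 0, ∀ᶠ z in 𝓝 y, ∀ n : ℕ, ρ.d (T^[n] y) (T^[n] z) < ε) :
    genEntropy ρ T ≤ constOrder := by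
  refine sSup_le ?_
  rintro _ ⟨_, ⟨ε, hε, rfl⟩, rfl⟩
  obtain ⟨s, -, hs⟩ := isCompact_univ.elim_nhds_subcover
    (fun y => {z | ∀ n : ℕ, ρ.d (T^[n] y) (T^[n] z) < ε / 2}) fun y _ => hT y _ (half_pos hε)
  have hsep (n : ℕ+) : sep ρ T n ε ≤ s.card := sep_le_card ρ T fun y => by
    obtain ⟨x, hx, hxy⟩ := mem_iUnion₂.1 (hs (mem_univ y))
    exact ⟨x, hx, (Finset.sup'_lt_iff _).2 fun i _ => hxy i⟩
  refine DedekindCut.principal_le_principal.2 ⟨s.card + 1, by positivity, fun n => ?_⟩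
  calc (sep ρ T n ε : ℝ) ≤ s.card := Nat.cast_le.2 (hsep n)
    _ ≤ (s.card + 1) * 1 := by linarith

end Entropy

section PushForward

variable {X : Type*} [TopologicalSpace X] [MeasurableSpace X] [BorelSpace X]

theorem iterate_measureInduced (T : C(X, X)) (n : ℕ) (μ : ProbabilityMeasure X) :
    (measureInduced T)^[n] μ = μ.map (T.continuous.iterate n).measurable.aemeasurable := by
  induction n with
  | zero => exact ProbabilityMeasure.toMeasure_injective Measure.map_id.symm
  | succ n ih =>
    rw [Function.iterate_succ_apply', ih]
    apply ProbabilityMeasure.toMeasure_injective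
    rw [ProbabilityMeasure.toMeasure_map, Function.iterate_succ']
    exact Measure.map_map T.continuous.measurable (T.continuous.iterate n).measurable

theorem integral_iterate_measureInduced (T : C(X, X)) (n : ℕ) (μ : ProbabilityMeasure X)
    (f : C(X, ℝ)) :
    ∫ x, f x ∂((measureInduced T)^[n] μ : Measure X) = ∫ x, f (T^[n] x) ∂(μ : Measure X) := by
  rw [iterate_measureInduced, ProbabilityMeasure.toMeasure_map]
  exact integral_map (T.continuous.iterate n).measurable.aemeasurable
    f.continuous.measurable.aestronglyMeasurable

variable [CompactSpace X]

theorem lipschitzWith_integral (μ : ProbabilityMeasure X) :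
    LipschitzWith 1 fun f : C(X, ℝ) => ∫ x, f x ∂(μ : Measure X) := by
  have hint (f : C(X, ℝ)) : Integrable f (μ : Measure X) :=
    f.continuous.integrable_of_hasCompactSupport (HasCompactSupport.of_compactSpace f)
  refine LipschitzWith.of_dist_le_mul fun f g => ?_
  rw [dist_eq_norm, dist_eq_norm, ← integral_sub (hint f) (hint g)]
  simpa using norm_integral_le_of_norm_le_const (μ := (μ : Measure X))
    (Eventually.of_forall fun x => (f - g).norm_coe_le_norm x)

theorem continuous_integral_prod :
    Continuous fun z : C(X, ℝ) × ProbabilityMeasure X => ∫ x, z.1 x ∂(z.2 : Measure X) :=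
  continuous_prod_of_continuous_lipschitzWith _ 1
    ProbabilityMeasure.continuous_integral_continuousMap lipschitzWith_integral

theorem continuous_measureInduced_prod :
    Continuous fun z : C(X, X) × ProbabilityMeasure X => measureInduced z.1 z.2 := by
  rw [ProbabilityMeasure.continuous_iff_forall_continuousMap_continuous_integral]
  intro f
  have hf (z : C(X, X) × ProbabilityMeasure X) :
      ∫ x, f x ∂(measureInduced z.1 z.2 : Measure X) = ∫ x, (f.comp z.1) x ∂(z.2 : Measure X) :=
    integral_iterate_measureInduced z.1 1 z.2 f
  simp_rw [hf]
  exact continuous_integral_prod.comp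
    (((ContinuousMap.continuous_postcomp f).comp continuous_fst).prodMk continuous_snd)

end PushForward

theorem isCompact_closure_range_of_equicontinuous {ι X Z : Type*} [TopologicalSpace X]
    [CompactSpace X] [MetricSpace Z] [CompactSpace Z] {F : ι → C(X, Z)}
    (hF : Equicontinuous fun i => ⇑(F i)) : IsCompact (closure (range F)) := by
  let e := (ContinuousMap.isometryEquivBoundedOfCompact X Z).toHomeomorph
  have heq : Equicontinuous ((↑) : e '' range F → X → Z) := by
    intro x U hU
    filter_upwards [hF x U hU] with y hy
    rintro ⟨_, _, ⟨i, rfl⟩, rfl⟩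
    exact hy i
  rw [← e.isCompact_image, e.image_closure]
  exact BoundedContinuousFunction.arzela_ascoli univ isCompact_univ _ (fun _ _ _ => mem_univ _) heq

theorem genEntropy_measureInduced_eq_constOrder {X : Type*} [MetricSpace X] [CompactSpace X]
    [MeasurableSpace X] [BorelSpace X] [Nonempty X] (ρ : CompatibleMetric (ProbabilityMeasure X))
    (T : C(X, X)) (hT : Equicontinuous fun n : ℕ => T^[n]) :
    genEntropy ρ (measureInduced T) = constOrder := by
  have : Nonempty (ProbabilityMeasure X) := ‹Nonempty X›.map diracProba
  refine (genEntropy_le_constOrder ρ _ fun μ ε hε => ?_).antisymm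
    (constOrder_le_genEntropy ρ _)
  let F (n : ℕ) : C(X, X) := ⟨T^[n], T.continuous.iterate n⟩
  have hG : IsCompact (closure (range F)) := isCompact_closure_range_of_equicontinuous hT
  have hcont : Continuous fun z : C(X, X) × ProbabilityMeasure X =>
      ρ.d (measureInduced z.1 μ) (measureInduced z.1 z.2) :=
    ρ.continuous_d.comp ((continuous_measureInduced_prod.comp
      (continuous_fst.prodMk continuous_const)).prodMk continuous_measureInduced_prod)
  obtain ⟨U, V, -, hV, hGU, hμV, hUV⟩ := generalized_tube_lemma hG (isCompact_singleton (x := μ))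
    (isOpen_Iio.preimage hcont) (n := _ ⁻¹' Iio ε) (by
      rintro ⟨g, ν⟩ ⟨-, rfl⟩
      simpa only [mem_preimage, ρ.d_self, mem_Iio] using hε)
  filter_upwards [hV.mem_nhds (hμV rfl)] with ν hν n
  rw [iterate_measureInduced, iterate_measureInduced]
  exact hUV (mk_mem_prod (hGU (subset_closure (mem_range_self n))) hν)

/-- `U` is wandering for `f` if it is disjoint from all its proper preimages `f⁻ⁿ(U)`, `n > 0`. It
is phrased with preimages so as to make sense for maps that are not invertible. -/
def IsWandering {X : Type*} (f : X → X) (U : Set X) : Prop :=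
  ∀ n, 0 < n → Disjoint U (f^[n] ⁻¹' U)

namespace IsWandering

variable {X Z : Type*} {f : X → X} {U : Set X}

theorem iterate_notMem (hU : IsWandering f U) {x : X} (hx : x ∈ U) {n : ℕ} (hn : 0 < n) :
    f^[n] x ∉ U :=
  Set.disjoint_left.1 (hU n hn) hx

theorem image {g : Z → Z} {V : Set Z} (hV : IsWandering g V) {ψ : Z → X}
    (hψ : Function.Injective ψ) (h : Function.Semiconj ψ g f) : IsWandering f (ψ '' V) := by
  rintro n hn
  rw [Set.disjoint_left]
  rintro _ ⟨z, hz, rfl⟩ hmem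
  rw [mem_preimage, ← (h.iterate_right n).eq z, hψ.mem_set_image] at hmem
  exact hV.iterate_notMem hz hn hmem

end IsWandering

section Monotone

variable {α : Type*} [Preorder α] {g : α → α} {y : α}

theorem isWandering_Ioo_of_le_map (hg : Monotone g) (hy : y ≤ g y) :
    IsWandering g (Ioo y (g y)) := by
  intro n hn
  refine Set.disjoint_left.2 fun z hz hmem => hmem.2.not_ge ?_
  calc g y ≤ g^[n] y := by
        simpa using hg.monotone_iterate_of_le_map hy hn
    _ ≤ g^[n] z := hg.iterate n hz.1.le

theorem isWandering_Ioo_of_map_le (hg : Monotone g) (hy : g y ≤ y) :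
    IsWandering g (Ioo (g y) y) := by
  intro n hn
  refine Set.disjoint_left.2 fun z hz hmem => hmem.1.not_ge ?_
  calc g^[n] z ≤ g^[n] y := hg.iterate n hz.2.le
    _ ≤ g y := by simpa using hg.antitone_iterate_of_map_le hy hn

end Monotone

theorem exists_isWandering_Ioo_of_map_ne {α : Type*} [LinearOrder α] {g : α → α} (hg : Monotone g)
    {y : α} (hy : g y ≠ y) : ∃ a b, a < b ∧ IsWandering g (Ioo a b) := by
  rcases hy.lt_or_gt with h | h
  · exact ⟨g y, y, h, isWandering_Ioo_of_map_le hg h.le⟩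
  · exact ⟨y, g y, h, isWandering_Ioo_of_le_map hg h.le⟩

section Iterate

variable {X : Type*} [TopologicalSpace X] {f : X → X} {U : Set X}

theorem exists_finset_subset_preimage_iterate (hf : Continuous f) (hU : IsOpen U)
    (hne : U.Nonempty) (h : ∀ V ⊆ U, IsOpen V → V.Nonempty → ¬IsWandering f V) (k : ℕ) :
    ∃ (s : Finset ℕ) (V : Set X), s.card = k ∧ V ⊆ U ∧ IsOpen V ∧ V.Nonempty ∧
      ∀ n ∈ s, V ⊆ f^[n] ⁻¹' U := by
  induction k with
  | zero => exact ⟨∅, U, rfl, subset_rfl, hU, hne, by simp⟩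
  | succ k ih =>
    obtain ⟨s, V, rfl, hVU, hV, hVne, hs⟩ := ih
    obtain ⟨n, hn, hVn⟩ : ∃ n, 0 < n ∧ ¬Disjoint V (f^[n] ⁻¹' V) := by
      simpa only [IsWandering, not_forall, exists_prop] using h V hVU hV hVne
    refine ⟨insert 0 (s.map (addRightEmbedding n)), V ∩ f^[n] ⁻¹' V, ?_,
      inter_subset_left.trans hVU, hV.inter (hV.preimage (hf.iterate n)),
      Set.not_disjoint_iff_nonempty_inter.1 hVn, ?_⟩
    · rw [Finset.card_insert_of_notMem (by simp [hn.ne']), Finset.card_map]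
    · simp only [Finset.forall_mem_insert, Finset.forall_mem_map, addRightEmbedding_apply]
      refine ⟨inter_subset_left.trans hVU, fun m hm x hx => ?_⟩
      rw [mem_preimage, Function.iterate_add_apply]
      exact hs m hm hx.2

theorem IsWandering.exists_of_iterate {q : ℕ} (hq : 0 < q) (h : IsWandering f^[q] U)
    (hf : Continuous f) (hU : IsOpen U) (hne : U.Nonempty) :
    ∃ V ⊆ U, IsOpen V ∧ V.Nonempty ∧ IsWandering f V := by
  by_contra! hV
  obtain ⟨s, V, hcard, -, -, ⟨x, hx⟩, hs⟩ :=
    exists_finset_subset_preimage_iterate hf hU hne hV (q + 1)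
  -- Two of the `q + 1` return times of `x` to `U` differ by a multiple of `q`.
  obtain ⟨m, hm, n, hn, hmn, hmod⟩ : ∃ m ∈ s, ∃ n ∈ s, m < n ∧ m ≡ n [MOD q] := by
    obtain ⟨m, hm, n, hn, hmn, hmod⟩ := Finset.exists_ne_map_eq_of_card_lt_of_maps_to
      (s := s) (t := Finset.range q) (f := (· % q)) (by simp [hcard])
      (fun m _ => by simpa using Nat.mod_lt m hq)
    rcases hmn.lt_or_gt with hlt | hlt
    · exact ⟨m, hm, n, hn, hlt, hmod⟩
    · exact ⟨n, hn, m, hm, hlt, hmod.symm⟩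
  obtain ⟨d, hd⟩ := (Nat.modEq_iff_dvd' hmn.le).1 hmod
  obtain rfl : n = q * d + m := by omega
  have hd : 0 < d := Nat.pos_of_ne_zero (by rintro rfl; simp at hmn)
  refine h.iterate_notMem (hs m hm hx) hd ?_
  rw [← Function.iterate_mul, ← Function.iterate_add_apply]
  exact hs _ hn hx

end Iterate

theorem exists_pmf_forall_ne_le_abs_sum_sub {k : ℕ} (hk : k ≠ 0) :
    ∃ P : PMF (Fin k), ∃ δ > 0, ∀ s t : Finset (Fin k), s ≠ t →
      δ ≤ |∑ l ∈ s, (P l).toReal - ∑ l ∈ t, (P l).toReal| := by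
  have : NeZero k := ⟨hk⟩
  -- Subsets of `Fin k` are determined by their sums of powers of two.
  let w (l : Fin k) : ENNReal := 2 ^ (l : ℕ)
  have hw0 : ∑' l, w l ≠ 0 := fun h => by simpa [w] using ENNReal.tsum_eq_zero.1 h 0
  have hw : ∑' l, w l ≠ ⊤ := by
    rw [tsum_fintype]
    exact ENNReal.sum_ne_top.2 fun l _ => ENNReal.pow_ne_top ENNReal.ofNat_ne_top
  set c := (∑' l, w l)⁻¹.toReal
  have hc : 0 < c := ENNReal.toReal_pos (ENNReal.inv_ne_zero.2 hw) (ENNReal.inv_ne_top.2 hw0)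
  have hsum (s : Finset (Fin k)) : ∑ l ∈ s, (PMF.normalize w hw0 hw l).toReal =
      ((∑ i ∈ s.map Fin.valEmbedding, 2 ^ i : ℕ) : ℤ) * c := by
    simp [PMF.normalize_apply, w, c, Finset.sum_mul]
  refine ⟨PMF.normalize w hw0 hw, c, hc, fun s t hst => ?_⟩
  have hne : ∑ i ∈ s.map Fin.valEmbedding, 2 ^ i ≠ ∑ i ∈ t.map Fin.valEmbedding, 2 ^ i :=
    fun h => hst (Finset.map_injective _ (Finset.geomSum_injective le_rfl h))
  rw [hsum, hsum, ← sub_mul, abs_mul, abs_of_pos hc, ← Int.cast_sub, ← Int.cast_abs]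
  refine le_mul_of_one_le_left hc.le (Int.cast_one_le_of_pos (abs_pos.2 (sub_ne_zero.2 ?_)))
  exact_mod_cast hne

theorem IsWandering.exists_continuousMap_iterate_eq_ite {X : Type*} [TopologicalSpace X]
    [NormalSpace X] [T1Space X] {T : X → X} {U : Set X} (hU : IsWandering T U)
    (hT : Function.Surjective T) (hUo : IsOpen U) (hne : U.Nonempty) :
    ∃ (f : C(X, ℝ)) (p : ℕ → X), ∀ i j, f (T^[j] (p i)) = if i = j then 1 else 0 := by
  obtain ⟨x, hx⟩ := hne
  obtain ⟨f, hf0, hf1, -⟩ := exists_continuous_zero_one_of_isClosed hUo.isClosed_compl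
    (isClosed_singleton (x := x)) (Set.disjoint_singleton_right.2 (not_not_intro hx))
  choose p hp using fun i => hT.iterate i x
  refine ⟨f, p, fun i j => ?_⟩
  rcases lt_trichotomy i j with h | rfl | h
  · rw [if_neg h.ne]
    refine hf0 ?_
    rw [← Nat.sub_add_cancel h.le, Function.iterate_add_apply, hp]
    exact hU.iterate_notMem hx (Nat.sub_pos_of_lt h)
  · rw [if_pos rfl, hp]
    exact hf1 rfl
  · rw [if_neg h.ne']
    refine hf0 fun hmem => hU.iterate_notMem hmem (Nat.sub_pos_of_lt h) ?_
    rwa [← Function.iterate_add_apply, Nat.sub_add_cancel h.le, hp]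

section LowerBound

variable {X : Type*} [TopologicalSpace X] [CompactSpace X] [T2Space X] [MeasurableSpace X]
  [BorelSpace X] (ρ : CompatibleMetric (ProbabilityMeasure X)) {T : C(X, X)}

theorem exists_pow_le_sep_measureInduced {f : C(X, ℝ)} {p : ℕ → X}
    (hfp : ∀ i j, f (T^[j] (p i)) = if i = j then 1 else 0) {k : ℕ} (hk : k ≠ 0) :
    ∃ ε > 0, ∀ n : ℕ+, (n : ℕ) ^ k ≤ sep ρ (measureInduced T) n ε := by
  obtain ⟨P, δ, hδ, hP⟩ := exists_pmf_forall_ne_le_abs_sum_sub hk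
  let ν : ProbabilityMeasure (Fin k) := ⟨P.toMeasure, inferInstance⟩
  let μ {n : ℕ} (a : Fin k → Fin n) : ProbabilityMeasure X :=
    ν.map (f := fun l => p (a l)) (measurable_of_finite _).aemeasurable
  have hμ {n : ℕ} (a : Fin k → Fin n) (j : Fin n) :
      ∫ x, f x ∂((measureInduced T)^[j] (μ a) : Measure X) =
        ∑ l with a l = j, (P l).toReal := by
    have hfj : Continuous fun x => f (T^[j] x) := f.continuous.comp (T.continuous.iterate j)
    rw [integral_iterate_measureInduced, ProbabilityMeasure.toMeasure_map, integral_map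
      (measurable_of_finite _).aemeasurable hfj.measurable.aestronglyMeasurable]
    simp only [ν, ProbabilityMeasure.coe_mk, PMF.integral_eq_sum, hfp, smul_eq_mul, mul_ite,
      mul_one, mul_zero, Fin.val_inj, Finset.sum_filter]
  obtain ⟨ε, hε, h⟩ := exists_card_le_sep ρ (measureInduced T)
    (ProbabilityMeasure.continuous_integral_continuousMap f) hδ
  refine ⟨ε, hε, fun n => ?_⟩
  have hcard : Fintype.card (Fin k → Fin n) = (n : ℕ) ^ k := by simp
  refine hcard ▸ h n (fun a : Fin k → Fin n => μ a) fun a b hab => ?_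
  obtain ⟨l, hl⟩ := Function.ne_iff.1 hab
  refine ⟨a l, (a l).isLt, ?_⟩
  rw [hμ, hμ]
  exact hP _ _ fun heq => hl.symm (by simpa using Finset.ext_iff.1 heq l)

theorem IsWandering.supOrders_polynomialOrders_le_genEntropy {U : Set X} (hU : IsWandering T U)
    (hT : Function.Surjective T) (hUo : IsOpen U) (hne : U.Nonempty) :
    supOrders polynomialOrders ≤ genEntropy ρ (measureInduced T) := by
  obtain ⟨f, p, hfp⟩ := hU.exists_continuousMap_iterate_eq_ite hT hUo hne
  exact GrowthOrder.supOrders_polynomialOrders_le_genEntropy ρ _ fun k hk =>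
    exists_pow_le_sep_measureInduced ρ hfp hk

end LowerBound

section Circle

open Real (pi_pos two_pi_pos)
open scoped Real

/-- `Circle.exp` as a chart: it maps `(θ, θ + 2π)` homeomorphically onto the circle minus the point
`exp θ`, so that maps and connected sets avoiding this point can be lifted to the line. -/
noncomputable def expChart (θ : ℝ) : OpenPartialHomeomorph ℝ Circle :=
  have : Fact (0 < 2 * π) := ⟨two_pi_pos⟩
  (AddCircle.openPartialHomeomorphCoe (2 * π) θ).transHomeomorph AddCircle.homeomorphCircle'

theorem expChart_source (θ : ℝ) : (expChart θ).source = Ioo θ (θ + 2 * π) := rfl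

theorem expChart_target (θ : ℝ) : (expChart θ).target = {Circle.exp θ}ᶜ := by
  ext z
  rw [mem_compl_singleton_iff, ← AddCircle.homeomorphCircle'.symm.injective.ne_iff]
  exact Iff.of_eq (congrArg (AddCircle.homeomorphCircle'.symm z ≠ ·)
    (AddCircle.homeomorphCircle'.symm_apply_apply _).symm)

theorem exists_isOpenEmbedding_range_eq_compl_singleton (p : Circle) :
    ∃ ψ : ℝ → Circle, IsOpenEmbedding ψ ∧ range ψ = {p}ᶜ := by
  set θ := (p : ℂ).arg
  let u : OpenPartialHomeomorph ℝ ℝ := OpenPartialHomeomorph.univBall (θ + π) π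
  have hu : u.target = (expChart θ).source := by
    rw [OpenPartialHomeomorph.univBall_target _ pi_pos, Real.ball_eq_Ioo, expChart_source]
    ring_nf
  let e := u.trans' (expChart θ) hu
  have he : e.source = univ := by
    rw [← OpenPartialHomeomorph.univBall_source (θ + π) π]
    rfl
  refine ⟨e, e.isOpenEmbedding he, ?_⟩
  calc range e = e.target := by rw [← image_univ, ← he, e.image_source_eq_target]
    _ = {Circle.exp θ}ᶜ := expChart_target θ
    _ = {p}ᶜ := by rw [Circle.exp_arg]

instance : Infinite Circle :=
  have ⟨_, hψ, _⟩ := exists_isOpenEmbedding_range_eq_compl_singleton 1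
  .of_injective _ hψ.injective

instance : LocallyConnectedSpace Circle :=
  ChartedSpace.locallyConnectedSpace (EuclideanSpace ℝ (Fin 1)) Circle

theorem dist_exp_le (s t : ℝ) : dist (Circle.exp s) (Circle.exp t) ≤ dist s t := by
  change dist (Circle.exp s : ℂ) (Circle.exp t) ≤ dist s t
  simpa [circleMap] using (lipschitzWith_circleMap 0 1).dist_le_mul s t

theorem exists_image_Ioo_subset_subset_image_Icc {C : Set Circle} (hC : IsPreconnected C) :
    ∃ a ∈ Icc (-π) (3 * π), ∃ b ∈ Icc (-π) (3 * π),
      Circle.exp '' Ioo a b ⊆ C ∧ C ⊆ Circle.exp '' Icc a b := by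
  have hπ := pi_pos
  rcases C.eq_empty_or_nonempty with rfl | hne
  · exact ⟨π, by constructor <;> linarith, π, by constructor <;> linarith, by simp⟩
  by_cases huniv : C = univ
  · subst huniv
    refine ⟨-π, by constructor <;> linarith, 3 * π, by constructor <;> linarith, subset_univ _,
      Circle.surjOn_exp_neg_pi_pi.trans (image_mono fun t ht => ⟨ht.1.le, by linarith [ht.2]⟩)⟩
  obtain ⟨p, hp⟩ := (ne_univ_iff_exists_notMem C).1 huniv
  set e := expChart (p : ℂ).arg
  have htarget : C ⊆ e.target := by
    rw [expChart_target, Circle.exp_arg]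
    exact subset_compl_singleton_iff.2 hp
  have hJ : IsConnected (e.symm '' C) :=
    ⟨hne.image _, hC.image _ (e.symm.continuousOn.mono htarget)⟩
  have hexp : Circle.exp '' (e.symm '' C) = C := (e.rightInvOn.mono htarget).image_image
  have hsub : e.symm '' C ⊆ Icc (-π) (3 * π) := by
    rintro _ ⟨z, hz, rfl⟩
    have hmem : e.symm z ∈ Ioo (p : ℂ).arg ((p : ℂ).arg + 2 * π) := e.map_target (htarget hz)
    exact ⟨(Complex.neg_pi_lt_arg _).le.trans hmem.1.le,
      by linarith [hmem.2, Complex.arg_le_pi (p : ℂ)]⟩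
  have hsub' : closure (e.symm '' C) ⊆ Icc (-π) (3 * π) := closure_minimal hsub isClosed_Icc
  have hbelow := bddBelow_Icc.mono hsub
  have habove := bddAbove_Icc.mono hsub
  refine ⟨_, hsub' (csInf_mem_closure hJ.nonempty hbelow), _,
    hsub' (csSup_mem_closure hJ.nonempty habove), ?_⟩
  exact ⟨(image_mono (hJ.Ioo_csInf_csSup_subset hbelow habove)).trans hexp.subset,
    hexp.superset.trans (image_mono (subset_Icc_csInf_csSup hbelow habove))⟩

theorem finite_frontier_of_isPreconnected {C : Set Circle} (hC : IsPreconnected C) :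
    (frontier C).Finite := by
  obtain ⟨a, -, b, -, hsub, hsup⟩ := exists_image_Ioo_subset_subset_image_Icc hC
  have hclosed : IsClosed (Circle.exp '' Icc a b) :=
    (isCompact_Icc.image Circle.exp.continuous).isClosed
  have hopen : IsOpen (Circle.exp '' Ioo a b) :=
    isLocalHomeomorph_circleExp.isOpenMap _ isOpen_Ioo
  refine ((Set.toFinite {a, b}).image Circle.exp).subset fun z hz => ?_
  obtain ⟨t, ht, rfl⟩ := closure_minimal hsup hclosed hz.1
  have htI : t ∉ Ioo a b := fun h => hz.2 (interior_maximal hsub hopen (mem_image_of_mem _ h))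
  rcases eq_endpoints_or_mem_Ioo_of_mem_Icc ht with h | h | h
  · exact mem_image_of_mem _ (Or.inl h)
  · exact mem_image_of_mem _ (Or.inr h)
  · exact absurd h htI

theorem exists_finite_isOpen_subset_of_le_dist {ε : ℝ} (hε : 0 < ε) :
    ∃ 𝒦 : Set (Set Circle), 𝒦.Finite ∧ (∀ K ∈ 𝒦, IsOpen K ∧ K.Nonempty) ∧
      ∀ C, IsPreconnected C → ∀ u ∈ C, ∀ v ∈ C, ε ≤ dist u v → ∃ K ∈ 𝒦, K ⊆ C := by
  let arc (k : ℤ) : Set Circle := Circle.exp '' Ioo (k * (ε / 2)) ((k + 1) * (ε / 2))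
  refine ⟨arc '' Icc ⌈-π / (ε / 2)⌉ ⌈3 * π / (ε / 2)⌉, (finite_Icc _ _).image _, ?_, ?_⟩
  · rintro _ ⟨k, -, rfl⟩
    exact ⟨isLocalHomeomorph_circleExp.isOpenMap _ isOpen_Ioo,
      (nonempty_Ioo.2 (by linarith)).image _⟩
  · intro C hC u hu v hv huv
    obtain ⟨a, ha, b, -, hsub, hsup⟩ := exists_image_Ioo_subset_subset_image_Icc hC
    obtain ⟨s, hs, rfl⟩ := hsup hu
    obtain ⟨t, ht, rfl⟩ := hsup hv
    have hab : ε ≤ b - a := huv.trans ((dist_exp_le s t).trans (Real.dist_le_of_mem_Icc hs ht))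
    refine ⟨_, ⟨⌈a / (ε / 2)⌉, ⟨by gcongr; exact ha.1, by gcongr; exact ha.2⟩, rfl⟩, ?_⟩
    refine (image_mono (Ioo_subset_Ioo ?_ ?_)).trans hsub
    · rw [← div_le_iff₀ (half_pos hε)]
      exact Int.le_ceil _
    · have := Int.ceil_lt_add_one (a / (ε / 2))
      rw [← sub_lt_iff_lt_add, lt_div_iff₀ (half_pos hε)] at this
      linarith

end Circle

theorem exists_pos_forall_biUnion_ne_univ (X : Type*) [MetricSpace X] [Infinite X] (N : ℕ) :
    ∃ d > 0, ∀ {ι : Type*} (s : Finset ι), s.card ≤ N → ∀ c : ι → Set X,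
      (∀ i ∈ s, ∀ a ∈ c i, ∀ b ∈ c i, dist a b < d) → ⋃ i ∈ s, c i ≠ univ := by
  obtain ⟨P, hP⟩ := Infinite.exists_subset_card_eq X (N + 2)
  have hPnt : (P : Set X).Nontrivial := Finset.one_lt_card_iff_nontrivial.1 (by omega)
  refine ⟨(P : Set X).infsep, P.infsep_pos_iff_nontrivial.2 hPnt, fun s hs c hc hcov => ?_⟩
  have hmem (z : X) : ∃ i ∈ s, z ∈ c i := by
    simpa only [mem_iUnion, exists_prop] using hcov.superset (mem_univ z)
  choose i his hic using hmem
  obtain ⟨z, hz, w, hw, hzw, hi⟩ := Finset.exists_ne_map_eq_of_card_lt_of_maps_to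
    (s := P) (t := s) (f := i) (by omega) fun z _ => his z
  have hlt := hc _ (his z) z (hic z) w (hi ▸ hic w)
  exact hlt.not_ge (infsep_le_dist_of_mem hz hw hzw)

section CompactSpace

variable {X : Type*}

theorem uniformEquicontinuous_iterate_of_iterate_eq_id [UniformSpace X] [CompactSpace X]
    {f : X → X} (hf : Continuous f) {N : ℕ} (hN : 0 < N) (h : f^[N] = id) :
    UniformEquicontinuous fun n : ℕ => f^[n] := by
  have hfin : UniformEquicontinuous fun i : Fin N => f^[i] :=
    uniformEquicontinuous_finite.2 fun i =>
      CompactSpace.uniformContinuous_of_continuous (hf.iterate i)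
  convert hfin.comp fun n : ℕ => ⟨n % N, Nat.mod_lt n hN⟩ using 1
  ext n x
  have hx : Function.IsPeriodicPt f N x := congrFun h x
  exact (hx.iterate_mod_apply n).symm

theorem exists_isPreconnected_diam_lt_of_dist_lt [PseudoMetricSpace X] [CompactSpace X]
    [LocallyConnectedSpace X] {ε : ℝ} (hε : 0 < ε) :
    ∃ δ > 0, ∀ x y : X, dist x y < δ →
      ∃ C, IsPreconnected C ∧ x ∈ C ∧ y ∈ C ∧ Metric.diam C < ε := by
  have h (x : X) : ∃ V ⊆ Metric.ball x (ε / 3), IsOpen V ∧ x ∈ V ∧ IsConnected V :=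
    locallyConnectedSpace_iff_subsets_isOpen_isConnected.1 ‹_› x _
      (Metric.ball_mem_nhds x (by positivity))
  choose V hVb hVo hxV hVc using h
  obtain ⟨δ, hδ, hV⟩ := lebesgue_number_lemma_of_metric isCompact_univ hVo
    fun x _ => mem_iUnion.2 ⟨x, hxV x⟩
  refine ⟨δ, hδ, fun x y hxy => ?_⟩
  obtain ⟨i, hi⟩ := hV x trivial
  refine ⟨V i, (hVc i).isPreconnected, hi (Metric.mem_ball_self hδ),
    hi (Metric.mem_ball'.2 hxy), ?_⟩
  calc Metric.diam (V i) ≤ Metric.diam (Metric.ball i (ε / 3)) :=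
        Metric.diam_mono (hVb i) Metric.isBounded_ball
    _ ≤ 2 * (ε / 3) := Metric.diam_ball (by positivity)
    _ < ε := by linarith

theorem iUnion_preimage_zpow_ne_univ [MetricSpace X] [CompactSpace X] [Infinite X] (T : X ≃ₜ X)
    {K : Set X} (hK : IsOpen K)
    (hsmall : ∀ δ > 0, ∃ n : ℤ, Metric.diam (⇑(T ^ n) ⁻¹' K) < δ) :
    ⋃ m : ℤ, ⇑(T ^ m) ⁻¹' K ≠ univ := by
  intro hcov
  obtain ⟨s, hs⟩ := isCompact_univ.elim_finite_subcover (fun m : ℤ => ⇑(T ^ m) ⁻¹' K)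
    (fun m => hK.preimage (T ^ m).continuous) hcov.superset
  obtain ⟨d, hd, hd'⟩ := exists_pos_forall_biUnion_ne_univ X s.card
  obtain ⟨δ, hδ, hδ'⟩ : ∃ δ > 0, ∀ a b, dist a b < δ →
      ∀ m : s, dist ((T ^ (m : ℤ)).symm a) ((T ^ (m : ℤ)).symm b) < d :=
    Metric.uniformEquicontinuous_iff.1 (uniformEquicontinuous_finite.2 fun m : s =>
      CompactSpace.uniformContinuous_of_continuous (T ^ (m : ℤ)).symm.continuous) d hd
  obtain ⟨n, hn⟩ := hsmall δ hδ
  have hcover : univ ⊆ ⋃ m ∈ s, ⇑(T ^ n) ⁻¹' (⇑(T ^ m) ⁻¹' K) := by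
    simpa only [preimage_univ, preimage_iUnion] using preimage_mono (f := T ^ n) hs
  -- The sets of this cover are small, as `T ^ n` commutes with each `T ^ m`.
  refine hd' s le_rfl _ (fun m hm a ha b hb => ?_) (univ_subset_iff.1 hcover)
  have hcomm (x : X) : (T ^ m) ((T ^ n) x) = (T ^ n) ((T ^ m) x) :=
    DFunLike.congr_fun (zpow_mul_comm T m n) x
  simp only [mem_preimage, hcomm] at ha hb
  have hclose : dist ((T ^ m) a) ((T ^ m) b) < δ :=
    (Metric.dist_le_diam_of_mem Metric.isBounded_of_compactSpace (mem_preimage.2 ha)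
      (mem_preimage.2 hb)).trans_lt hn
  simpa using hδ' _ _ hclose ⟨m, hm⟩

end CompactSpace

theorem exists_mem_periodicPts_of_mapsTo {α : Type*} {f : α → α} {F : Set α} (hF : F.Finite)
    (hne : F.Nonempty) (h : MapsTo f F F) : ∃ z, z ∈ Function.periodicPts f := by
  obtain ⟨z, hz⟩ := hne
  obtain ⟨a, b, hab, heq⟩ := hF.exists_lt_map_eq_of_forall_mem fun n => h.iterate n hz
  refine ⟨f^[a] z, Function.mk_mem_periodicPts (Nat.sub_pos_of_lt hab) ?_⟩
  rw [Function.IsPeriodicPt, Function.IsFixedPt, ← Function.iterate_add_apply,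
    Nat.sub_add_cancel hab.le, heq]

section Homeomorph

variable {X : Type*} [TopologicalSpace X]

theorem coe_pow_eq_iterate (T : X ≃ₜ X) (n : ℕ) : ⇑(T ^ n) = T^[n] :=
  hom_coe_pow _ rfl (fun _ _ => rfl) T n

theorem preimage_pow_iUnion_preimage_zpow (T : X ≃ₜ X) (K : Set X) (n : ℕ) :
    ⇑(T ^ n) ⁻¹' ⋃ m : ℤ, ⇑(T ^ m) ⁻¹' K = ⋃ m : ℤ, ⇑(T ^ m) ⁻¹' K := by
  calc ⇑(T ^ n) ⁻¹' ⋃ m : ℤ, ⇑(T ^ m) ⁻¹' K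
    _ = ⋃ m : ℤ, ⇑(T ^ (m + n)) ⁻¹' K := by
      simp only [preimage_iUnion, zpow_add, zpow_natCast]
      rfl
    _ = ⋃ m : ℤ, ⇑(T ^ m) ⁻¹' K :=
      (Equiv.addRight (n : ℤ)).surjective.iUnion_comp fun m => ⇑(T ^ m) ⁻¹' K

theorem image_connectedComponentIn_eq (S : X ≃ₜ X) {V : Set X} (hV : S ⁻¹' V = V) {x z : X}
    (hz : z ∈ connectedComponentIn V x) (hSz : S z ∈ connectedComponentIn V x) :
    S '' connectedComponentIn V x = connectedComponentIn V x := by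
  have hSV : S '' V = V := by simpa only [hV] using S.image_preimage V
  calc S '' connectedComponentIn V x = S '' connectedComponentIn V z := by
        rw [connectedComponentIn_eq hz]
    _ = connectedComponentIn V (S z) := by
        rw [S.image_connectedComponentIn (connectedComponentIn_subset V x hz), hSV]
    _ = connectedComponentIn V x := (connectedComponentIn_eq hSz).symm

end Homeomorph

theorem exists_isOpen_forall_diam_preimage_iterate_lt {f : Circle → Circle} (hf : Continuous f)
    (hinj : Function.Injective f) (h : ¬UniformEquicontinuous fun n : ℕ => f^[n]) :
    ∃ K, IsOpen K ∧ K.Nonempty ∧ ∀ δ > 0, ∃ n, Metric.diam (f^[n] ⁻¹' K) < δ := by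
  replace h := mt Metric.uniformEquicontinuous_iff.2 h
  push Not at h
  obtain ⟨ε, hε, hfar⟩ := h
  obtain ⟨𝒦, hfin, hopen, h𝒦⟩ := exists_finite_isOpen_subset_of_le_dist hε
  by_contra! hcon
  obtain ⟨δ, hδ, hle⟩ : ∃ δ > 0, ∀ K ∈ 𝒦, ∀ n, δ ≤ Metric.diam (f^[n] ⁻¹' K) := by
    have hK (K) (hK : K ∈ 𝒦) : ∀ᶠ δ in 𝓝[>] (0 : ℝ), ∀ n, δ ≤ Metric.diam (f^[n] ⁻¹' K) := by
      obtain ⟨δ, hδ, hle⟩ := hcon K (hopen K hK).1 (hopen K hK).2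
      filter_upwards [nhdsWithin_le_nhds (Iic_mem_nhds hδ)] with δ' hδ' n using hδ'.trans (hle n)
    exact (Eventually.and (eventually_mem_nhdsWithin (s := Ioi (0 : ℝ)))
      ((eventually_all_finite hfin).2 hK)).exists
  obtain ⟨η, hη, hconn⟩ := exists_isPreconnected_diam_lt_of_dist_lt (X := Circle) hδ
  obtain ⟨x, y, hxy, n, hn⟩ := hfar η hη
  obtain ⟨C, hC, hxC, hyC, hCδ⟩ := hconn x y hxy
  obtain ⟨K, hK, hKC⟩ := h𝒦 _ (hC.image _ (hf.iterate n).continuousOn) _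
    (mem_image_of_mem _ hxC) _ (mem_image_of_mem _ hyC) hn
  have hpre : f^[n] ⁻¹' K ⊆ C := by
    simpa only [(hinj.iterate n).preimage_image] using preimage_mono (f := f^[n]) hKC
  exact ((hle K hK n).trans (Metric.diam_mono hpre Metric.isBounded_of_compactSpace)).not_gt hCδ

theorem iterate_eq_id_or_exists_isWandering {T : Circle ≃ₜ Circle} {q : ℕ} (hq : 0 < q)
    {p : Circle} (hp : Function.IsPeriodicPt T q p) :
    (∃ N > 0, T^[N] = id) ∨ ∃ U, IsOpen U ∧ U.Nonempty ∧ IsWandering T U := by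
  obtain ⟨ψ, hψ, hrange⟩ := exists_isOpenEmbedding_range_eq_compl_singleton p
  have hinv (t : ℝ) : ∃ s, ψ s = T^[q] (ψ t) := by
    have hne : ψ t ∈ ({p}ᶜ : Set Circle) := hrange ▸ mem_range_self t
    rw [← mem_range, hrange, mem_compl_singleton_iff, ← hp.eq]
    exact (T.injective.iterate q).ne hne
  choose g hg using hinv
  have hcont : Continuous g := by
    rw [hψ.isInducing.continuous_iff, show ψ ∘ g = T^[q] ∘ ψ from funext hg]
    exact (T.continuous.iterate q).comp hψ.continuous
  have hinj : Function.Injective g := fun s t hst =>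
    hψ.injective (T.injective.iterate q (by rw [← hg, hst, hg]))
  have hmono : Monotone g^[2] := by
    rcases hcont.strictMono_of_inj hinj with h | h
    · exact (h.comp h).monotone
    · exact (h.comp h).monotone
  have hsemi : Function.Semiconj ψ g^[2] T^[q * 2] := by
    rw [Function.iterate_mul]
    exact Function.Semiconj.iterate_right hg 2
  by_cases hid : ∀ t, g^[2] t = t
  · refine Or.inl ⟨q * 2, by omega, funext fun z => ?_⟩
    by_cases hz : z = p
    · exact hz ▸ hp.mul_const 2
    · obtain ⟨t, rfl⟩ : z ∈ range ψ := hrange ▸ hz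
      rw [← hsemi.eq, hid, id]
  · obtain ⟨t, ht⟩ := not_forall.1 hid
    obtain ⟨a, b, hab, hI⟩ := exists_isWandering_Ioo_of_map_ne hmono ht
    obtain ⟨U, -, hU⟩ := (hI.image hψ.injective hsemi).exists_of_iterate (by omega) T.continuous
      (hψ.isOpenMap _ isOpen_Ioo) ((nonempty_Ioo.2 hab).image ψ)
    exact Or.inr ⟨U, hU⟩

theorem exists_isPeriodicPt_of_image_pow_eq {T : Circle ≃ₜ Circle} {n : ℕ} (hn : 0 < n)
    {I : Set Circle} (hI : IsPreconnected I) (hne : I.Nonempty) (huniv : I ≠ univ)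
    (h : ⇑(T ^ n) '' I = I) : ∃ q > 0, ∃ p, Function.IsPeriodicPt T q p := by
  have hmaps : MapsTo (T ^ n) (frontier I) (frontier I) := by
    rw [mapsTo_iff_image_subset, (T ^ n).image_frontier, h]
  obtain ⟨p, k, hk, hp⟩ := exists_mem_periodicPts_of_mapsTo (finite_frontier_of_isPreconnected hI)
    (nonempty_frontier_iff.2 ⟨hne, huniv⟩) hmaps
  refine ⟨n * k, Nat.mul_pos hn hk, p, ?_⟩
  rwa [Function.IsPeriodicPt, Function.iterate_mul, ← coe_pow_eq_iterate T n]

theorem uniformEquicontinuous_or_exists_isWandering (T : Circle ≃ₜ Circle) :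
    UniformEquicontinuous (fun n : ℕ => T^[n]) ∨
      ∃ U, IsOpen U ∧ U.Nonempty ∧ IsWandering T U := by
  refine or_iff_not_imp_left.2 fun hT => ?_
  obtain ⟨K, hK, ⟨x, hxK⟩, hsmall⟩ :=
    exists_isOpen_forall_diam_preimage_iterate_lt T.continuous T.injective hT
  set V : Set Circle := ⋃ m : ℤ, ⇑(T ^ m) ⁻¹' K
  have hVuniv : V ≠ univ := iUnion_preimage_zpow_ne_univ T hK fun δ hδ =>
    (hsmall δ hδ).imp' Nat.cast fun n hn => by rwa [zpow_natCast, coe_pow_eq_iterate]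
  have hV : IsOpen V := isOpen_iUnion fun m => hK.preimage (T ^ m).continuous
  have hxV : x ∈ V := mem_iUnion.2 ⟨0, hxK⟩
  set I := connectedComponentIn V x
  have hI : I.Nonempty := ⟨x, mem_connectedComponentIn hxV⟩
  by_cases hw : IsWandering T I
  · exact ⟨I, hV.connectedComponentIn, hI, hw⟩
  obtain ⟨n, hn, z, hz, hTz⟩ : ∃ n > 0, ∃ z ∈ I, (T ^ n) z ∈ I := by
    simpa only [IsWandering, not_forall, Set.not_disjoint_iff, exists_prop,
      mem_preimage, coe_pow_eq_iterate] using hw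
  have hTI : ⇑(T ^ n) '' I = I :=
    image_connectedComponentIn_eq _ (preimage_pow_iUnion_preimage_zpow T K n) hz hTz
  obtain ⟨q, hq, p, hp⟩ := exists_isPeriodicPt_of_image_pow_eq hn
    isPreconnected_connectedComponentIn hI
    (fun h => hVuniv (univ_subset_iff.1 (h ▸ connectedComponentIn_subset V x))) hTI
  refine (iterate_eq_id_or_exists_isWandering hq hp).resolve_left ?_
  rintro ⟨N, hN, hid⟩
  exact hT (uniformEquicontinuous_iterate_of_iterate_eq_id T.continuous hN hid)

end GrowthOrder

theorem corollary3 (T : Circle ≃ₜ Circle)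
    (ρ : GrowthOrder.CompatibleMetric (MeasureTheory.ProbabilityMeasure Circle)) :
    GrowthOrder.supOrders GrowthOrder.polynomialOrders ≤
        GrowthOrder.genEntropy ρ (GrowthOrder.measureInduced (T : C(Circle, Circle))) ∨
      GrowthOrder.genEntropy ρ (GrowthOrder.measureInduced (T : C(Circle, Circle))) =
        GrowthOrder.constOrder := by
  rcases GrowthOrder.uniformEquicontinuous_or_exists_isWandering T with hT | ⟨U, hUo, hne, hU⟩
  · exact Or.inr (GrowthOrder.genEntropy_measureInduced_eq_constOrder ρ _ hT.equicontinuous)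
  · exact Or.inl (hU.supOrders_polynomialOrders_le_genEntropy ρ T.surjective hUo hne)
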